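/- Let $p,d,K,n\ge 1$ be integers, $\mu\ge 0$ and $\delta\in(0,1)$. Let $\mathcal X\subset\mathbb R^p$ be compact with $\max_{x\in\mathcal X}\|x\|_\infty=\bar X>0$, let $(X,Y)$ be a random pair with values in $\mathcal X\times\mathcal Y$, where $\mathcal Y$ is a measurable space, and let $S=\{(x^s,y^s)\}_{s=1}^n$ be independent samples, each distributed as $(X,Y)$. Let $\varphi:\mathbb R^d\times\mathcal Y\to\mathbb R$ be such that $\varphi(z;\cdot)$ is measurable for every $z$ and, for some $L_\varphi>0$, $C_\varphi>0$, $z_0\in\mathbb R^d$ and every $y\in\mathcal Y$, the function $\varphi(\cdot;y)$ is Lipschitz continuous on $\mathbb R^d$ with modulus $L_\varphi$ for the Euclidean norm $\|\cdot\|$, and $|\varphi(z_0;y)|\le C_\varphi$. Let $\mathcal H_\mu^K$ be the class of all piecewise affine decision rules $f=(f_1,\dots,f_d):\mathcal X\to\mathbb R^d$ of the form $$f_\iota(x)=\max_{1\le k\le K}\{(\alpha_\iota^k)^\top x+a_\iota^k\}-\max_{1\le k\le K}\{(\beta_\iota^k)^\top x+b_\iota^k\},\qquad \iota=1,\dots,d,$$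 with $\alpha_\iota^k,\beta_\iota^k\in\mathbb R^p$ and $a_\iota^k,b_\iota^k\in\mathbb R$ all of whose entries have absolute value at most $\mu$. Put $$R(f)=\mathbb E[\varphi(f(X);Y)],\qquad \widehat R_S(f)=\frac1n\sum_{s=1}^n\varphi(f(x^s);y^s),\qquad M_\mu=C_\varphi+L_\varphi\bigl(2\sqrt d\,\mu(p\bar X+1)+\|z_0\|\bigr).$$ Then $R(f)$ is well defined (that is, $\varphi(f(X);Y)$ is integrable) for every $f\in\mathcal H_\mu^K$, the maximum $\max_{f\in\mathcal H_\mu^K}|R(f)-\widehat R_S(f)|$ is attained for every sample and is a random variable, and with probability at least $1-\delta$ over the draw of $S$, $$\max_{f\in\mathcal H_\mu^K}\bigl|R(f)-\widehat R_S(f)\bigr|\le\frac{8\mu L_\varphi\sqrt{2dK(p+1)(p\bar X^2+1)}}{n}+2M_\mu\sqrt{\frac{2dK(p+1)\log n}{n}}+\sqrt2\,M_\mu\sqrt{\frac{\log(2/\delta)}{n}}.$$ -/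

import Mathlib

open MeasureTheory ProbabilityTheory
open scoped NNReal

noncomputable section

namespace PADR

/-- The parameter `(α^k, a^k, β^k, b^k)_{k ∈ [K]}` of one scalar piecewise affine function on `ℝ^p`.
Norms of `Fin _ → _` and of products are maxima, so `‖θ‖` is the maximum `‖θ‖_∞` of the absolute
values of all `2 K (p + 1)` entries. -/
abbrev Param (p K : ℕ) : Type := Fin K → (Fin p → ℝ) × ℝ × (Fin p → ℝ) × ℝ

/-- `x ↦ max_k (α^k · x + a^k) - max_k (β^k · x + b^k)` (the suprema range over the finite set
`Fin K`, so they are maxima for `K ≥ 1`). -/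
def paFun {p K : ℕ} (θ : Param p K) (x : Fin p → ℝ) : ℝ :=
  (⨆ k : Fin K, ((θ k).1 ⬝ᵥ x + (θ k).2.1)) - ⨆ k : Fin K, ((θ k).2.2.1 ⬝ᵥ x + (θ k).2.2.2)

/-- The class of piecewise affine decision rules `𝒳 → ℝ^d` whose `d` coordinates are differences of
two max-affine functions with `K` pieces each, all parameters being at most `μ` in absolute value. -/
def ruleClass {p : ℕ} (𝒳 : Set (Fin p → ℝ)) (d K : ℕ) (μ : ℝ) :
    Set (𝒳 → EuclideanSpace ℝ (Fin d)) :=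
  {f | ∃ θ : Fin d → Param p K, (∀ ι, ‖θ ι‖ ≤ μ) ∧ ∀ (x : 𝒳) (ι : Fin d), f x ι = paFun (θ ι) x}

/-- The expected cost `R(f) = E[φ(f(X); Y)]`, where `D` is the joint law of `(X, Y)`. -/
def risk {F Y Z : Type*} [MeasurableSpace F] [MeasurableSpace Y]
    (D : Measure (F × Y)) (φ : Z → Y → ℝ) (f : F → Z) : ℝ :=
  ∫ w, φ (f w.1) w.2 ∂D

/-- The empirical cost `(1/n) ∑_s φ(f(x^s); y^s)` of the sample `S = ((x^s, y^s))_s`. -/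
def empRisk {F Y Z : Type*} {n : ℕ} (φ : Z → Y → ℝ) (S : Fin n → F × Y) (f : F → Z) : ℝ :=
  (1 / (n : ℝ)) * ∑ s, φ (f (S s).1) (S s).2

/-- The set of all gaps `|R(f) - R̂_S(f)|` for `f` in the class `H`. -/
def gaps {F Y Z : Type*} [MeasurableSpace F] [MeasurableSpace Y] {n : ℕ}
    (D : Measure (F × Y)) (φ : Z → Y → ℝ) (H : Set (F → Z)) (S : Fin n → F × Y) : Set ℝ :=
  (fun f => |risk D φ f - empRisk φ S f|) '' H

/-- The uniform gap `sup_{f ∈ H} |R(f) - R̂_S(f)|`. -/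
def uniformGap {F Y Z : Type*} [MeasurableSpace F] [MeasurableSpace Y] {n : ℕ}
    (D : Measure (F × Y)) (φ : Z → Y → ℝ) (H : Set (F → Z)) (S : Fin n → F × Y) : ℝ :=
  sSup (gaps D φ H S)

/-- `M_μ = C_φ + L_φ (2 √d μ (p X̄ + 1) + ‖z₀‖)`. -/
def costBound (p d : ℕ) (μ Xbar L C : ℝ) (z₀ : EuclideanSpace ℝ (Fin d)) : ℝ :=
  C + L * (2 * √(d : ℝ) * μ * (p * Xbar + 1) + ‖z₀‖)

end PADR

end

/-!
The cost of the decision rule with parameters `θ` is Lipschitz in `θ` for the sup norm, with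
constant `2 L √d (p X̄ + 1)`, so the deviation of its empirical mean from its expectation is
Lipschitz with twice that constant. Hoeffding's inequality and a union bound control the deviation
at the centres of `n ^ (2 d K (p + 1))` balls of radius `μ / n` that cover the cube of parameters,
and moving from any `θ` to the nearest centre costs at most `4 L √d (p X̄ + 1) μ / n`. The maximum
is attained because the cube is compact, and it is measurable because the supremum may be taken
over a countable dense set of parameters.
-/

noncomputable section

namespace PADR

open Metric Set

section CoveringNumbers

variable {ε : ℝ≥0}

lemma exists_finset_isCover_of_coveringNumber_le {X : Type*} [PseudoEMetricSpace X] {A : Set X}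
    {N : ℕ} (hA : coveringNumber ε A ≤ N) :
    ∃ F : Finset X, ↑F ⊆ A ∧ IsCover ε A ↑F ∧ F.card ≤ N := by
  obtain ⟨F, hFA, hfin, hF, hcard⟩ :=
    exists_set_encard_eq_coveringNumber (hA.trans_lt (ENat.natCast_lt_top N)).ne
  lift F to Finset X using hfin
  rw [← hcard, encard_coe_eq_coe_finsetCard, Nat.cast_le] at hA
  exact ⟨F, hFA, hF, hA⟩

lemma coveringNumber_prod_le {X Y : Type*} [PseudoEMetricSpace X] [PseudoEMetricSpace Y]
    {A : Set X} {B : Set Y} {M N : ℕ} (hA : coveringNumber ε A ≤ M)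
    (hB : coveringNumber ε B ≤ N) : coveringNumber ε (A ×ˢ B) ≤ (M * N : ℕ) := by
  obtain ⟨F, hFA, hF, hFM⟩ := exists_finset_isCover_of_coveringNumber_le hA
  obtain ⟨G, hGB, hG, hGN⟩ := exists_finset_isCover_of_coveringNumber_le hB
  have hsub : (↑(F ×ˢ G) : Set (X × Y)) ⊆ A ×ˢ B := by
    rw [Finset.coe_product]
    exact prod_mono hFA hGB
  have hcover : IsCover ε (A ×ˢ B) (↑(F ×ˢ G) : Set (X × Y)) := by
    rintro ⟨x, y⟩ ⟨hx, hy⟩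
    obtain ⟨a, ha, hxa⟩ := hF hx
    obtain ⟨b, hb, hyb⟩ := hG hy
    exact ⟨(a, b), Finset.mem_product.2 ⟨ha, hb⟩, show edist (x, y) (a, b) ≤ ε from max_le hxa hyb⟩
  refine (hcover.coveringNumber_le_encard hsub).trans ?_
  rw [encard_coe_eq_coe_finsetCard, Finset.card_product]
  exact_mod_cast Nat.mul_le_mul hFM hGN

lemma coveringNumber_closedBall_prod_le {X Y : Type*} [PseudoMetricSpace X] [PseudoMetricSpace Y]
    {c : X × Y} {r : ℝ} {M N : ℕ} (hM : coveringNumber ε (closedBall c.1 r) ≤ M)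
    (hN : coveringNumber ε (closedBall c.2 r) ≤ N) :
    coveringNumber ε (closedBall c r) ≤ (M * N : ℕ) := by
  simpa only [closedBall_prod_same] using coveringNumber_prod_le hM hN

lemma coveringNumber_univ_pi_le {ι : Type*} [Fintype ι] {X : ι → Type*}
    [∀ i, PseudoEMetricSpace (X i)] {A : ∀ i, Set (X i)} {N : ι → ℕ}
    (hA : ∀ i, coveringNumber ε (A i) ≤ N i) :
    coveringNumber ε (univ.pi A) ≤ (∏ i, N i : ℕ) := by
  classical
  choose F hFA hF hFN using fun i => exists_finset_isCover_of_coveringNumber_le (hA i)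
  have hsub : (↑(Fintype.piFinset F) : Set (∀ i, X i)) ⊆ univ.pi A := by
    rw [Fintype.coe_piFinset]
    exact pi_mono fun i _ => hFA i
  have hcover : IsCover ε (univ.pi A) (↑(Fintype.piFinset F) : Set (∀ i, X i)) := by
    intro x hx
    choose a ha hxa using fun i => hF i (hx i (mem_univ i))
    exact ⟨a, Fintype.mem_piFinset.2 ha, edist_pi_le_iff.2 hxa⟩
  refine (hcover.coveringNumber_le_encard hsub).trans ?_
  rw [encard_coe_eq_coe_finsetCard, Fintype.card_piFinset]
  exact_mod_cast Finset.prod_le_prod' fun i _ => hFN i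

lemma coveringNumber_closedBall_pi_le {ι X : Type*} [Fintype ι] [PseudoMetricSpace X]
    {c : ι → X} {r : ℝ} (hr : 0 ≤ r) {N : ℕ}
    (hN : ∀ i, coveringNumber ε (closedBall (c i) r) ≤ N) :
    coveringNumber ε (closedBall c r) ≤ (N ^ Fintype.card ι : ℕ) := by
  rw [closedBall_pi c hr]
  simpa using coveringNumber_univ_pi_le hN

lemma exists_nat_lt_abs_sub_le {ε t : ℝ} {n : ℕ} (hn : n ≠ 0) (ht₀ : 0 ≤ t) (ht : t ≤ 2 * n * ε) :
    ∃ i < n, |t - (2 * i + 1) * ε| ≤ ε := by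
  induction n, Nat.one_le_iff_ne_zero.2 hn using Nat.le_induction with
  | base => exact ⟨0, by simp, abs_le.2 ⟨by simpa, by push_cast at *; linarith⟩⟩
  | succ n hn' ih =>
    push_cast at ht
    obtain htn | htn := le_total t (2 * n * ε)
    · obtain ⟨i, hi, hti⟩ := ih (by omega) htn
      exact ⟨i, by omega, hti⟩
    · exact ⟨n, by omega, abs_le.2 ⟨by linarith, by linarith⟩⟩

lemma coveringNumber_closedBall_natCast_mul_le {n : ℕ} (hn : n ≠ 0) (c : ℝ) :
    coveringNumber ε (closedBall c (n * ε)) ≤ n := by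
  set a : ℕ → ℝ := fun i => c - n * ε + (2 * i + 1) * ε with ha
  have hsub : (↑((Finset.range n).image a) : Set ℝ) ⊆ closedBall c (n * ε) := by
    intro y hy
    obtain ⟨i, hi, rfl⟩ := Finset.mem_image.1 hy
    have hi' : (i : ℝ) + 1 ≤ n := by exact_mod_cast Finset.mem_range.1 hi
    rw [Real.closedBall_eq_Icc]
    constructor <;> nlinarith [ε.coe_nonneg, i.cast_nonneg (α := ℝ)]
  have hcover : IsCover ε (closedBall c (n * ε)) (↑((Finset.range n).image a) : Set ℝ) := by
    intro t ht
    rw [Real.closedBall_eq_Icc] at ht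
    obtain ⟨i, hi, hti⟩ := exists_nat_lt_abs_sub_le (t := t - (c - n * ε)) hn
      (by linarith [ht.1]) (by linarith [ht.2])
    refine ⟨a i, Finset.mem_coe.2 (Finset.mem_image_of_mem a (Finset.mem_range.2 hi)), ?_⟩
    change edist t (a i) ≤ ε
    rwa [edist_nndist, ENNReal.coe_le_coe, ← NNReal.coe_le_coe, coe_nndist, Real.dist_eq, ha,
      ← sub_sub]
  refine (hcover.coveringNumber_le_encard hsub).trans ?_
  rw [encard_coe_eq_coe_finsetCard]
  exact_mod_cast Finset.card_image_le.trans_eq (Finset.card_range n)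

end CoveringNumbers

section Lipschitz

lemma lipschitzWith_pi {ι X : Type*} [Fintype ι] {Y : ι → Type*} [PseudoEMetricSpace X]
    [∀ i, PseudoEMetricSpace (Y i)] {Λ : ℝ≥0} {f : X → ∀ i, Y i}
    (hf : ∀ i, LipschitzWith Λ fun x => f x i) : LipschitzWith Λ f :=
  fun x x' => edist_pi_le_iff.2 fun i => hf i x x'

lemma lipschitzWith_iSup {ι X : Type*} [Finite ι] [PseudoMetricSpace X] {Λ : ℝ≥0}
    {f : ι → X → ℝ} (hf : ∀ i, LipschitzWith Λ (f i)) : LipschitzWith Λ fun x => ⨆ i, f i x := by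
  cases isEmpty_or_nonempty ι
  · simpa only [Real.iSup_of_isEmpty] using LipschitzWith.const' 0
  refine LipschitzWith.of_le_add_mul Λ fun x x' => ciSup_le fun i => ?_
  calc f i x ≤ f i x' + Λ * dist x x' := (hf i).le_add_mul x x'
    _ ≤ (⨆ j, f j x') + Λ * dist x x' := by
      gcongr
      exact le_ciSup (finite_range fun j => f j x').bddAbove i

lemma norm_dotProduct_le {ι R : Type*} [Fintype ι] [NonUnitalSeminormedRing R] (u x : ι → R) :
    ‖u ⬝ᵥ x‖ ≤ Fintype.card ι * ‖x‖ * ‖u‖ :=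
  calc ‖u ⬝ᵥ x‖ ≤ ∑ _i : ι, ‖u‖ * ‖x‖ := norm_sum_le_of_le _ fun i _ =>
        (norm_mul_le _ _).trans (by gcongr <;> exact norm_le_pi_norm _ i)
    _ = Fintype.card ι * ‖x‖ * ‖u‖ := by
        rw [Finset.sum_const, Finset.card_univ, nsmul_eq_mul]
        ring

lemma lipschitzWith_dotProduct_add {ι : Type*} [Fintype ι] (x : ι → ℝ) :
    LipschitzWith (Fintype.card ι * ‖x‖₊ + 1) fun q : (ι → ℝ) × ℝ => q.1 ⬝ᵥ x + q.2 := by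
  have hdot : LipschitzWith (Fintype.card ι * ‖x‖₊) fun u : ι → ℝ => u ⬝ᵥ x :=
    LipschitzWith.of_dist_le_mul fun u v => by
      simpa only [dist_eq_norm, ← sub_dotProduct, NNReal.coe_mul, NNReal.coe_natCast, coe_nnnorm]
        using norm_dotProduct_le (u - v) x
  simpa using (hdot.comp LipschitzWith.prod_fst).add LipschitzWith.prod_snd

end Lipschitz

section Hoeffding

variable {Ω E : Type*} [MeasurableSpace Ω] [MeasurableSpace E] {n : ℕ} {D : Measure E}
  {P : Measure Ω}

/-- The distance between the mean of a function `g` under the law `D` and its empirical mean over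
the sample `T`; the gaps of a class of rules are the deviations of the costs of its members. -/
def deviation (D : Measure E) (T : Fin n → E) (g : E → ℝ) : ℝ :=
  |∫ e, g e ∂D - 1 / (n : ℝ) * ∑ s, g (T s)|

lemma measurable_deviation {g : E → ℝ} (hg : Measurable g) :
    Measurable fun T : Fin n → E => deviation D T g :=
  (((Finset.measurable_sum _ fun s _ => hg.comp (measurable_pi_apply s)).const_mul _).const_sub
    _).abs

variable [IsProbabilityMeasure P] {S : Fin n → Ω → E} {g : E → ℝ} {M : ℝ}

lemma hasSubgaussianMGF_comp_sub_integral {X : Ω → E} (hX : HasLaw X D P) (hg : Measurable g)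
    (hgM : ∀ e, |g e| ≤ M) :
    HasSubgaussianMGF (fun ω => g (X ω) - ∫ e, g e ∂D) (‖M‖₊ ^ 2) P := by
  have hwidth : ‖M - -M‖₊ / 2 = ‖M‖₊ := by
    rw [sub_neg_eq_add, ← two_mul, nnnorm_mul, Real.nnnorm_ofNat, mul_div_cancel_left₀]
    exact two_ne_zero
  rw [← hX.integral_comp hg.aestronglyMeasurable, ← hwidth]
  exact hasSubgaussianMGF_of_mem_Icc (hg.comp_aemeasurable hX.aemeasurable)
    (ae_of_all _ fun ω => abs_le.1 (hgM (X ω)))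

lemma measureReal_le_mean_sub_integral_le (hn : n ≠ 0) (hS : ∀ s, HasLaw (S s) D P)
    (hindep : iIndepFun S P) (hg : Measurable g) (hgM : ∀ e, |g e| ≤ M) {t : ℝ} (ht : 0 ≤ t) :
    P.real {ω | t ≤ 1 / (n : ℝ) * ∑ s, g (S s ω) - ∫ e, g e ∂D} ≤
      Real.exp (-(n * t ^ 2 / (2 * M ^ 2))) := by
  have hn₀ : (0 : ℝ) < n := Nat.cast_pos.2 (Nat.pos_of_ne_zero hn)
  have hind : iIndepFun (fun s ω => g (S s ω) - ∫ e, g e ∂D) P :=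
    hindep.comp (fun _ e => g e - ∫ e, g e ∂D) fun _ => hg.sub_const _
  have hsum := HasSubgaussianMGF.measure_sum_ge_le_of_iIndepFun hind (s := Finset.univ)
    (fun s _ => hasSubgaussianMGF_comp_sub_integral (hS s) hg hgM)
    (mul_nonneg n.cast_nonneg ht)
  have hevent (ω : Ω) : n * t ≤ ∑ s, (g (S s ω) - ∫ e, g e ∂D) ↔
      t ≤ 1 / (n : ℝ) * ∑ s, g (S s ω) - ∫ e, g e ∂D := by
    rw [Finset.sum_sub_distrib, Finset.sum_const, Finset.card_univ, Fintype.card_fin, nsmul_eq_mul,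
      le_sub_iff_add_le, ← mul_add, mul_comm, ← le_div_iff₀ hn₀, div_eq_inv_mul,
      ← one_div, le_sub_iff_add_le]
  simp only [hevent] at hsum
  refine hsum.trans_eq (congrArg Real.exp ?_)
  simp only [Finset.sum_const, Finset.card_univ, Fintype.card_fin, nsmul_eq_mul, NNReal.coe_mul,
    NNReal.coe_natCast, NNReal.coe_pow, coe_nnnorm, Real.norm_eq_abs, sq_abs]
  field_simp

lemma measureReal_le_deviation_le (hn : n ≠ 0) (hS : ∀ s, HasLaw (S s) D P)
    (hindep : iIndepFun S P) (hg : Measurable g) (hgM : ∀ e, |g e| ≤ M) {t : ℝ} (ht : 0 ≤ t) :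
    P.real {ω | t ≤ deviation D (fun s => S s ω) g} ≤
      2 * Real.exp (-(n * t ^ 2 / (2 * M ^ 2))) := by
  have hupper := measureReal_le_mean_sub_integral_le hn hS hindep hg hgM ht
  have hlower := measureReal_le_mean_sub_integral_le hn hS hindep hg.neg
    (fun e => (abs_neg (g e)).trans_le (hgM e)) ht
  rw [two_mul]
  refine (measureReal_mono fun ω hω => ?_).trans
    ((measureReal_union_le _ _).trans (add_le_add hlower hupper))
  simp only [mem_union, mem_ofPred_eq, Pi.neg_apply, Finset.sum_neg_distrib, integral_neg]
  rw [mem_ofPred_eq, deviation] at hω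
  refine (le_abs.1 hω).imp (fun h => ?_) fun h => ?_ <;> linarith

lemma measureReal_lt_deviation_le (hn : n ≠ 0) (hS : ∀ s, HasLaw (S s) D P)
    (hindep : iIndepFun S P) (hg : Measurable g) (hM : 0 < M) (hgM : ∀ e, |g e| ≤ M) {η : ℝ}
    (hη : 0 < η) :
    P.real {ω | √2 * M * √(Real.log (2 / η) / n) < deviation D (fun s => S s ω) g} ≤ η := by
  obtain hη₁ | hη₁ := le_total 1 η
  · exact measureReal_le_one.trans hη₁
  have hlog : 0 ≤ Real.log (2 / η) := Real.log_nonneg ((one_le_div hη).2 (by linarith))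
  have hexponent : n * (√2 * M * √(Real.log (2 / η) / n)) ^ 2 / (2 * M ^ 2) =
      Real.log (2 / η) := by
    rw [mul_pow, mul_pow, Real.sq_sqrt zero_le_two, Real.sq_sqrt (by positivity)]
    field_simp
  calc P.real {ω | √2 * M * √(Real.log (2 / η) / n) < deviation D (fun s => S s ω) g}
      ≤ P.real {ω | √2 * M * √(Real.log (2 / η) / n) ≤ deviation D (fun s => S s ω) g} :=
        measureReal_mono (ofPred_subset_ofPred.2 fun ω => le_of_lt)
    _ ≤ 2 * Real.exp (-(n * (√2 * M * √(Real.log (2 / η) / n)) ^ 2 / (2 * M ^ 2))) :=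
        measureReal_le_deviation_le hn hS hindep hg hgM (by positivity)
    _ = η := by
        rw [hexponent, Real.exp_neg, Real.exp_log (by positivity), inv_div, mul_div_cancel₀]
        exact two_ne_zero

lemma measureReal_exists_lt_deviation_le {ι : Type*} {I : Finset ι} {m : ℕ} (hI : I.card ≤ m)
    (hn : n ≠ 0) (hS : ∀ s, HasLaw (S s) D P) (hindep : iIndepFun S P) {g : ι → E → ℝ}
    (hg : ∀ i ∈ I, Measurable (g i)) (hM : 0 < M) (hgM : ∀ i ∈ I, ∀ e, |g i e| ≤ M) {δ : ℝ}
    (hδ : 0 < δ) :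
    P.real {ω | ∃ i ∈ I, √2 * M * √(Real.log (2 * m / δ) / n) <
      deviation D (fun s => S s ω) (g i)} ≤ δ := by
  have htail : ∀ i ∈ I, P.real {ω | √2 * M * √(Real.log (2 * m / δ) / n) <
      deviation D (fun s => S s ω) (g i)} ≤ δ / m := fun i hi => by
    have hm : 0 < m := (Finset.card_pos.2 ⟨i, hi⟩).trans_le hI
    rw [← div_div_eq_mul_div]
    exact measureReal_lt_deviation_le hn hS hindep (hg i hi) hM (hgM i hi) (by positivity)
  calc P.real {ω | ∃ i ∈ I, √2 * M * √(Real.log (2 * m / δ) / n) <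
          deviation D (fun s => S s ω) (g i)}
      = P.real (⋃ i ∈ I, {ω | √2 * M * √(Real.log (2 * m / δ) / n) <
          deviation D (fun s => S s ω) (g i)}) := by
        congr 1
        ext ω
        simp only [mem_ofPred_eq, mem_iUnion, exists_prop]
    _ ≤ ∑ _i ∈ I, δ / m := (measureReal_biUnion_finset_le I _).trans (Finset.sum_le_sum htail)
    _ = I.card / m * δ := by
        rw [Finset.sum_const, nsmul_eq_mul]
        ring
    _ ≤ δ := mul_le_of_le_one_left hδ.le
        (div_le_one_of_le₀ (Nat.cast_le.2 hI) m.cast_nonneg)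

end Hoeffding

section UniformDeviation

lemma measurable_sSup_image {X Θ : Type*} [MeasurableSpace X] [TopologicalSpace Θ] {A : Set Θ}
    [TopologicalSpace.SeparableSpace A] {F : X → Θ → ℝ} (hc : ∀ x, ContinuousOn (F x) A)
    (hm : ∀ θ ∈ A, Measurable fun x => F x θ) : Measurable fun x => sSup (F x '' A) := by
  obtain ⟨Q, hQ, hQA⟩ := TopologicalSpace.exists_countable_dense A
  have := hQ.to_subtype
  have hsup (x : X) : sSup (F x '' A) = ⨆ θ : Q, F x θ := by
    rw [sSup_image']
    exact (hQA.ciSup' (hc x).domRestrict).symm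
  simp only [hsup]
  exact Measurable.iSup fun θ => hm _ θ.1.2

variable {Ω E Θ : Type*} [MeasurableSpace Ω] [MeasurableSpace E] [PseudoMetricSpace Θ] {n : ℕ}
  {D : Measure E} [IsProbabilityMeasure D] {A : Set Θ} {ℓ : Θ → E → ℝ} {Λ : ℝ≥0} {M : ℝ}

lemma lipschitzOnWith_deviation (hint : ∀ θ ∈ A, Integrable (ℓ θ) D)
    (hΛ : ∀ e, LipschitzOnWith Λ (fun θ => ℓ θ e) A) (T : Fin n → E) :
    LipschitzOnWith (2 * Λ) (fun θ => deviation D T (ℓ θ)) A := by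
  refine LipschitzOnWith.of_dist_le_mul fun θ hθ θ' hθ' => ?_
  set r : ℝ := Λ * dist θ θ'
  have hℓ (e : E) : |ℓ θ e - ℓ θ' e| ≤ r := (hΛ e).dist_le_mul θ hθ θ' hθ'
  have hmean : |∫ e, (ℓ θ e - ℓ θ' e) ∂D| ≤ r := by
    simpa using norm_integral_le_of_norm_le_const
      (f := fun e => ℓ θ e - ℓ θ' e) (ae_of_all D hℓ)
  have hemp : |1 / (n : ℝ) * ∑ s, (ℓ θ (T s) - ℓ θ' (T s))| ≤ r :=
    calc |1 / (n : ℝ) * ∑ s, (ℓ θ (T s) - ℓ θ' (T s))|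
        = 1 / (n : ℝ) * |∑ s, (ℓ θ (T s) - ℓ θ' (T s))| := by
          rw [abs_mul, abs_of_nonneg (by positivity)]
      _ ≤ 1 / (n : ℝ) * ∑ _s : Fin n, r := by
          gcongr
          exact (Finset.abs_sum_le_sum_abs _ _).trans (Finset.sum_le_sum fun s _ => hℓ (T s))
      _ = (n : ℝ)⁻¹ * n * r := by
          rw [Finset.sum_const, Finset.card_univ, Fintype.card_fin, nsmul_eq_mul]
          ring
      _ ≤ r := mul_le_of_le_one_left (by positivity) inv_mul_le_one
  rw [integral_sub (hint θ hθ) (hint θ' hθ')] at hmean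
  rw [Finset.sum_sub_distrib, mul_sub] at hemp
  calc dist (deviation D T (ℓ θ)) (deviation D T (ℓ θ'))
      ≤ |(∫ e, ℓ θ e ∂D - 1 / (n : ℝ) * ∑ s, ℓ θ (T s)) -
          (∫ e, ℓ θ' e ∂D - 1 / (n : ℝ) * ∑ s, ℓ θ' (T s))| := abs_abs_sub_abs_le _ _
    _ ≤ r + r := by
        rw [sub_sub_sub_comm]
        exact (abs_sub _ _).trans (add_le_add hmean hemp)
    _ = ↑(2 * Λ) * dist θ θ' := by
        rw [NNReal.coe_mul, NNReal.coe_ofNat]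
        ring

variable {P : Measure Ω} [IsProbabilityMeasure P] {S : Fin n → Ω → E}

lemma measureReal_exists_lt_deviation_le_of_coveringNumber_le {ε : ℝ≥0} {m : ℕ}
    (hA : coveringNumber ε A ≤ m) (hn : n ≠ 0) (hS : ∀ s, HasLaw (S s) D P)
    (hindep : iIndepFun S P) (hℓ : ∀ θ ∈ A, Measurable (ℓ θ)) (hM : 0 < M)
    (hℓM : ∀ θ ∈ A, ∀ e, |ℓ θ e| ≤ M) (hΛ : ∀ e, LipschitzOnWith Λ (fun θ => ℓ θ e) A) {δ : ℝ}
    (hδ : 0 < δ) :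
    P.real {ω | ∃ θ ∈ A, 2 * Λ * ε + √2 * M * √(Real.log (2 * m / δ) / n) <
      deviation D (fun s => S s ω) (ℓ θ)} ≤ δ := by
  obtain ⟨F, hFA, hF, hFm⟩ := exists_finset_isCover_of_coveringNumber_le hA
  have hint : ∀ θ ∈ A, Integrable (ℓ θ) D := fun θ hθ =>
    Integrable.of_bound (hℓ θ hθ).aestronglyMeasurable M (ae_of_all _ (hℓM θ hθ))
  refine (measureReal_mono ?_).trans (measureReal_exists_lt_deviation_le hFm hn hS hindep
    (fun θ hθ => hℓ θ (hFA hθ)) hM (fun θ hθ => hℓM θ (hFA hθ)) hδ)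
  rintro ω ⟨θ, hθ, hlt⟩
  obtain ⟨c, hc, hθc⟩ := hF hθ
  have hdist : dist θ c ≤ ε := by
    rwa [dist_nndist, NNReal.coe_le_coe, ← ENNReal.coe_le_coe, ← edist_nndist]
  have hdev := (le_abs_self _).trans
    ((lipschitzOnWith_deviation hint hΛ fun s => S s ω).dist_le_mul θ hθ c (hFA hc))
  have hnet : 2 * Λ * dist θ c ≤ 2 * Λ * ε := by gcongr
  rw [NNReal.coe_mul, NNReal.coe_ofNat] at hdev
  exact ⟨c, hc, by linarith⟩

lemma one_sub_le_measureReal_sSup_deviation_le {ε : ℝ≥0} {m : ℕ} (hA₀ : A.Nonempty)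
    (hA : coveringNumber ε A ≤ m) (hn : n ≠ 0) (hS : ∀ s, HasLaw (S s) D P)
    (hindep : iIndepFun S P) (hℓ : ∀ θ ∈ A, Measurable (ℓ θ)) (hM : 0 < M)
    (hℓM : ∀ θ ∈ A, ∀ e, |ℓ θ e| ≤ M) (hΛ : ∀ e, LipschitzOnWith Λ (fun θ => ℓ θ e) A) {δ : ℝ}
    (hδ : 0 < δ) :
    1 - δ ≤ P.real {ω | sSup ((fun θ => deviation D (fun s => S s ω) (ℓ θ)) '' A) ≤
      2 * Λ * ε + √2 * M * √(Real.log (2 * m / δ) / n)} := by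
  set G := {ω | sSup ((fun θ => deviation D (fun s => S s ω) (ℓ θ)) '' A) ≤
    2 * Λ * ε + √2 * M * √(Real.log (2 * m / δ) / n)}
  have hbad : P.real Gᶜ ≤ δ := by
    refine (measureReal_mono fun ω hω => ?_).trans
      (measureReal_exists_lt_deviation_le_of_coveringNumber_le hA hn hS hindep hℓ hM hℓM hΛ hδ)
    have hω' := not_le.1 (notMem_ofPred_iff.1 hω)
    obtain ⟨_, ⟨θ, hθ, rfl⟩, hlt⟩ := exists_lt_of_lt_csSup (hA₀.image _) hω'
    exact ⟨θ, hθ, hlt⟩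
  have hunion := measureReal_union_le (μ := P) G Gᶜ
  rw [union_compl_self, probReal_univ] at hunion
  linarith

end UniformDeviation

section PiecewiseAffine

variable {p d K : ℕ}

lemma lipschitzWith_paFun (x : Fin p → ℝ) :
    LipschitzWith (2 * (p * ‖x‖₊ + 1)) fun θ : Param p K => paFun θ x := by
  have haffine : LipschitzWith (p * ‖x‖₊ + 1)
      fun q : (Fin p → ℝ) × ℝ => q.1 ⬝ᵥ x + q.2 := by
    simpa only [Fintype.card_fin] using lipschitzWith_dotProduct_add x
  have heval (k : Fin K) : LipschitzWith 1 fun θ : Param p K => θ k := LipschitzWith.eval k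
  have hfst (k : Fin K) : LipschitzWith (p * ‖x‖₊ + 1)
      fun θ : Param p K => (θ k).1 ⬝ᵥ x + (θ k).2.1 := by
    simpa [Function.comp_def] using haffine.comp ((LipschitzWith.prod_fst.prodMk
      (LipschitzWith.prod_fst.comp LipschitzWith.prod_snd)).comp (heval k))
  have hsnd (k : Fin K) : LipschitzWith (p * ‖x‖₊ + 1)
      fun θ : Param p K => (θ k).2.2.1 ⬝ᵥ x + (θ k).2.2.2 := by
    simpa [Function.comp_def] using haffine.comp
      ((LipschitzWith.prod_snd.comp LipschitzWith.prod_snd).comp (heval k))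
  rw [two_mul]
  exact (lipschitzWith_iSup hfst).sub (lipschitzWith_iSup hsnd)

lemma measurable_paFun (θ : Param p K) : Measurable (paFun θ) := by
  have haffine (u : Fin p → ℝ) (a : ℝ) : Measurable fun x : Fin p → ℝ => u ⬝ᵥ x + a :=
    (continuous_const.dotProduct continuous_id).measurable.add_const a
  exact (Measurable.iSup fun k => haffine _ _).sub (Measurable.iSup fun k => haffine _ _)

/-- The piecewise affine decision rule on the whole of `ℝ^p` with parameters `θ`; its restrictions
to `𝒳` for parameters in the sup-norm ball of radius `μ` make up the class `ruleClass 𝒳 d K μ`. -/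
def rule (θ : Fin d → Param p K) (x : Fin p → ℝ) : EuclideanSpace ℝ (Fin d) :=
  WithLp.toLp 2 fun ι => paFun (θ ι) x

lemma ruleClass_eq_image {𝒳 : Set (Fin p → ℝ)} {μ : ℝ} (hμ : 0 ≤ μ) :
    ruleClass 𝒳 d K μ = (fun θ (x : 𝒳) => rule θ x) '' closedBall (0 : Fin d → Param p K) μ := by
  ext f
  simp only [ruleClass, mem_ofPred_eq, mem_image, mem_closedBall_zero_iff,
    pi_norm_le_iff_of_nonneg hμ (x := (_ : Fin d → Param p K))]
  refine exists_congr fun θ => and_congr_right fun _ => ⟨fun h => ?_, ?_⟩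
  · ext x ι
    exact (h x ι).symm
  · rintro rfl x ι
    rfl

lemma rule_zero (x : Fin p → ℝ) : rule (0 : Fin d → Param p K) x = 0 := by
  ext ι
  simp [rule, paFun]

lemma lipschitzWith_rule (x : Fin p → ℝ) :
    LipschitzWith (NNReal.sqrt d * (2 * (p * ‖x‖₊ + 1)))
      fun θ : Fin d → Param p K => rule θ x := by
  have hpi : LipschitzWith (2 * (p * ‖x‖₊ + 1))
      fun (θ : Fin d → Param p K) (ι : Fin d) => paFun (θ ι) x :=
    lipschitzWith_pi fun ι => by
      have heval : LipschitzWith 1 fun θ : Fin d → Param p K => θ ι := LipschitzWith.eval ι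
      simpa [Function.comp_def] using (lipschitzWith_paFun x).comp heval
  simpa [rule, NNReal.sqrt_eq_rpow, Function.comp_def] using
    (PiLp.lipschitzWith_toLp 2 fun _ : Fin d => ℝ).comp hpi

lemma measurable_rule (θ : Fin d → Param p K) : Measurable (rule θ) :=
  (PiLp.continuous_toLp 2 _).measurable.comp
    (measurable_pi_lambda _ fun ι => measurable_paFun (θ ι))

lemma coveringNumber_closedBall_param_le {n : ℕ} (hn : n ≠ 0) {μ : ℝ≥0} (c : Fin d → Param p K) :
    coveringNumber (μ / n) (closedBall c μ) ≤ (n ^ (2 * d * K * (p + 1)) : ℕ) := by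
  have hreal (t : ℝ) : coveringNumber (μ / n) (closedBall t μ) ≤ n := by
    have hμ : (n * (μ / n : ℝ≥0) : ℝ) = μ := by
      rw [NNReal.coe_div, NNReal.coe_natCast, mul_div_cancel₀ _ (Nat.cast_ne_zero.2 hn)]
    simpa only [hμ] using coveringNumber_closedBall_natCast_mul_le (ε := μ / n) hn t
  have hvector (u : Fin p → ℝ) : coveringNumber (μ / n) (closedBall u μ) ≤ (n ^ p : ℕ) := by
    simpa only [Fintype.card_fin] using
      coveringNumber_closedBall_pi_le μ.coe_nonneg fun i => hreal (u i)
  have hpiece (q : (Fin p → ℝ) × ℝ × (Fin p → ℝ) × ℝ) :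
      coveringNumber (μ / n) (closedBall q μ) ≤ (n ^ p * (n * (n ^ p * n)) : ℕ) :=
    coveringNumber_closedBall_prod_le (hvector _) <| coveringNumber_closedBall_prod_le (hreal _) <|
      coveringNumber_closedBall_prod_le (hvector _) (hreal _)
  have hparam (θ : Param p K) := coveringNumber_closedBall_pi_le μ.coe_nonneg fun k => hpiece (θ k)
  refine (coveringNumber_closedBall_pi_le μ.coe_nonneg fun ι => hparam (c ι)).trans_eq ?_
  rw [Fintype.card_fin, Fintype.card_fin]
  congr 1
  ring

end PiecewiseAffine

section Cost

variable {𝒴 : Type*} {p d K : ℕ} {𝒳 : Set (Fin p → ℝ)} {φ : EuclideanSpace ℝ (Fin d) → 𝒴 → ℝ}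

/-- The cost `φ(f_θ(x); y)` of the decision rule with parameters `θ` at the data point `(x, y)`. -/
def ruleCost (φ : EuclideanSpace ℝ (Fin d) → 𝒴 → ℝ) (θ : Fin d → Param p K) (w : 𝒳 × 𝒴) : ℝ :=
  φ (rule θ w.1) w.2

lemma gaps_ruleClass [MeasurableSpace 𝒴] {n : ℕ} (D : Measure (𝒳 × 𝒴)) {μ : ℝ} (hμ : 0 ≤ μ)
    (T : Fin n → 𝒳 × 𝒴) :
    gaps D φ (ruleClass 𝒳 d K μ) T = (fun θ : Fin d → Param p K => deviation D T (ruleCost φ θ)) ''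
      closedBall 0 μ := by
  rw [gaps, ruleClass_eq_image hμ, image_image]
  rfl

variable {L : ℝ≥0}

lemma measurable_ruleCost [MeasurableSpace 𝒴] (hφm : ∀ z, Measurable (φ z))
    (hφL : ∀ y, LipschitzWith L (fun z => φ z y)) (θ : Fin d → Param p K) :
    Measurable (ruleCost φ θ : 𝒳 × 𝒴 → ℝ) :=
  (measurable_uncurry_of_continuous_of_measurable (fun y => (hφL y).continuous) hφm).comp
    (((measurable_rule θ).comp (measurable_subtype_coe.comp measurable_fst)).prodMk measurable_snd)

variable {B : ℝ≥0}

lemma lipschitzWith_ruleCost (hB : ∀ x ∈ 𝒳, ‖x‖ ≤ B)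
    (hφL : ∀ y, LipschitzWith L (fun z => φ z y)) (w : 𝒳 × 𝒴) :
    LipschitzWith (L * (NNReal.sqrt d * (2 * (p * B + 1))))
      fun θ : Fin d → Param p K => ruleCost φ θ w := by
  refine ((hφL w.2).comp (lipschitzWith_rule (w.1 : Fin p → ℝ))).weaken ?_
  gcongr
  exact hB w.1 w.1.2

lemma norm_rule_le (hB : ∀ x ∈ 𝒳, ‖x‖ ≤ B) {μ : ℝ≥0} {θ : Fin d → Param p K} (hθ : ‖θ‖ ≤ μ)
    {x : Fin p → ℝ} (hx : x ∈ 𝒳) : ‖rule θ x‖ ≤ 2 * √d * μ * (p * B + 1) :=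
  calc ‖rule θ x‖ ≤ √d * (2 * (p * ‖x‖ + 1)) * ‖θ‖ := by
        simpa using (lipschitzWith_rule x).norm_le_mul (rule_zero x) θ
    _ ≤ √d * (2 * (p * B + 1)) * μ := by
        gcongr
        exact hB x hx
    _ = 2 * √d * μ * (p * B + 1) := by ring

lemma abs_ruleCost_le (hB : ∀ x ∈ 𝒳, ‖x‖ ≤ B) (hφL : ∀ y, LipschitzWith L (fun z => φ z y))
    {C : ℝ} {z₀ : EuclideanSpace ℝ (Fin d)} (hφC : ∀ y, |φ z₀ y| ≤ C) {μ : ℝ≥0}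
    {θ : Fin d → Param p K} (hθ : ‖θ‖ ≤ μ) (w : 𝒳 × 𝒴) :
    |ruleCost φ θ w| ≤ costBound p d μ B L C z₀ :=
  calc |ruleCost φ θ w| ≤ |φ z₀ w.2| + |φ (rule θ w.1) w.2 - φ z₀ w.2| := by
        simpa [ruleCost] using abs_add_le (φ z₀ w.2) (φ (rule θ w.1) w.2 - φ z₀ w.2)
    _ ≤ C + L * ‖rule θ w.1 - z₀‖ := by
        gcongr
        · exact hφC w.2
        · exact (hφL w.2).norm_sub_le _ _
    _ ≤ C + L * (2 * √d * μ * (p * B + 1) + ‖z₀‖) := by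
        gcongr
        exact (norm_sub_le _ _).trans (by gcongr; exact norm_rule_le hB hθ w.1.2)

lemma costBound_pos {C : ℝ} (hC : 0 < C) (p d : ℕ) (μ B L : ℝ≥0) (z₀ : EuclideanSpace ℝ (Fin d)) :
    0 < costBound p d μ B L C z₀ := by
  rw [costBound]
  positivity

end Cost

section Constants

lemma sqrt_add_le_sqrt_add_sqrt (a b : ℝ) : √(a + b) ≤ √a + √b := by
  refine Real.sqrt_le_iff.2 ⟨by positivity, ?_⟩
  have hab : 0 ≤ 2 * √a * √b := by positivity
  rw [add_sq, Real.sq_sqrt', Real.sq_sqrt']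
  linarith [le_max_left a 0, le_max_left b 0]

lemma sqrt_mul_add_one_le {p d K : ℕ} (hK : 1 ≤ K) (B : ℝ) :
    √d * (p * B + 1) ≤ √(2 * d * K * (p + 1) * (p * B ^ 2 + 1)) := by
  have hK' : (1 : ℝ) ≤ 2 * K := by
    exact_mod_cast hK.trans (Nat.le_mul_of_pos_left K two_pos)
  have hsq : (p * B + 1) ^ 2 ≤ (p + 1) * (p * B ^ 2 + 1) := by
    nlinarith [mul_nonneg p.cast_nonneg (sq_nonneg (B - 1))]
  refine Real.le_sqrt_of_sq_le ?_
  calc (√d * (p * B + 1)) ^ 2 = 1 * (d * (p * B + 1) ^ 2) := by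
        rw [mul_pow, Real.sq_sqrt d.cast_nonneg, one_mul]
    _ ≤ 2 * K * (d * ((p + 1) * (p * B ^ 2 + 1))) := by gcongr
    _ = 2 * d * K * (p + 1) * (p * B ^ 2 + 1) := by ring

lemma lipschitz_error_le {p d K n : ℕ} (hK : 1 ≤ K) (L B μ : ℝ≥0) :
    2 * (L * (NNReal.sqrt d * (2 * (p * B + 1))) : ℝ≥0) * (μ / n : ℝ≥0) ≤
      8 * μ * L * √(2 * d * K * (p + 1) * (p * B ^ 2 + 1)) / n :=
  calc (2 * (L * (NNReal.sqrt d * (2 * (p * B + 1))) : ℝ≥0) * (μ / n : ℝ≥0) : ℝ)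
      = 4 * μ * L * (√d * (p * B + 1)) / n := by
        push_cast
        ring
    _ ≤ 8 * μ * L * √(2 * d * K * (p + 1) * (p * B ^ 2 + 1)) / n := by
        gcongr
        · norm_num
        · exact sqrt_mul_add_one_le hK B

lemma union_bound_error_le {n : ℕ} (hn : n ≠ 0) (N : ℕ) {M δ : ℝ} (hM : 0 ≤ M) (hδ : δ ≠ 0) :
    √2 * M * √(Real.log (2 * (n ^ N : ℕ) / δ) / n) ≤
      2 * M * √(N * Real.log n / n) + √2 * M * √(Real.log (2 / δ) / n) := by
  have hn₀ : (n : ℝ) ≠ 0 := Nat.cast_ne_zero.2 hn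
  have hlog : Real.log (2 * (n ^ N : ℕ) / δ) = N * Real.log n + Real.log (2 / δ) := by
    rw [mul_div_right_comm, mul_comm, Nat.cast_pow,
      Real.log_mul (pow_ne_zero N hn₀) (div_ne_zero two_ne_zero hδ), Real.log_pow]
  calc √2 * M * √(Real.log (2 * (n ^ N : ℕ) / δ) / n)
      ≤ √2 * M * (√(N * Real.log n / n) + √(Real.log (2 / δ) / n)) := by
        rw [hlog, add_div]
        gcongr
        exact sqrt_add_le_sqrt_add_sqrt _ _
    _ = √2 * M * √(N * Real.log n / n) + √2 * M * √(Real.log (2 / δ) / n) := mul_add _ _ _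
    _ ≤ 2 * M * √(N * Real.log n / n) + √2 * M * √(Real.log (2 / δ) / n) := by
        gcongr
        exact Real.sqrt_le_iff.2 ⟨zero_le_two, by norm_num⟩

lemma lipschitz_error_add_union_bound_error_le {p d K n : ℕ} (hK : 1 ≤ K) (hn : n ≠ 0)
    (L B μ : ℝ≥0) {M δ : ℝ} (hM : 0 ≤ M) (hδ : δ ≠ 0) :
    2 * (L * (NNReal.sqrt d * (2 * (p * B + 1))) : ℝ≥0) * (μ / n : ℝ≥0) +
        √2 * M * √(Real.log (2 * (n ^ (2 * d * K * (p + 1)) : ℕ) / δ) / n) ≤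
      8 * μ * L * √(2 * d * K * (p + 1) * (p * B ^ 2 + 1)) / n +
        2 * M * √(2 * d * K * (p + 1) * Real.log n / n) + √2 * M * √(Real.log (2 / δ) / n) := by
  have hunion := union_bound_error_le hn (2 * d * K * (p + 1)) hM hδ
  rw [show ((2 * d * K * (p + 1) : ℕ) : ℝ) = 2 * d * K * (p + 1) by push_cast; rfl] at hunion
  rw [add_assoc]
  exact add_le_add (lipschitz_error_le hK L B μ) hunion

end Constants

end PADR

end

theorem proposition2_general
    {Ω 𝒴 : Type*} [MeasurableSpace Ω] [MeasurableSpace 𝒴] {p d K n : ℕ} (hK : 1 ≤ K) (hn : 1 ≤ n)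
    (𝒳 : Set (Fin p → ℝ)) (Xbar : ℝ) (hXbar : ∀ x ∈ 𝒳, ‖x‖ ≤ Xbar)
    (D : Measure (𝒳 × 𝒴)) [IsProbabilityMeasure D] (P : Measure Ω) [IsProbabilityMeasure P]
    (S : Fin n → Ω → 𝒳 × 𝒴) (hSm : ∀ s, Measurable (S s))
    (hSlaw : ∀ s, P.map (S s) = D) (hSindep : iIndepFun S P)
    (φ : EuclideanSpace ℝ (Fin d) → 𝒴 → ℝ) (hφm : ∀ z, Measurable (φ z))
    (L : ℝ≥0) (hφL : ∀ y, LipschitzWith L (fun z => φ z y))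
    (C : ℝ) (hC : 0 < C) (z₀ : EuclideanSpace ℝ (Fin d)) (hφC : ∀ y, |φ z₀ y| ≤ C)
    (μ : ℝ) (hμ : 0 ≤ μ) (δ : ℝ) (hδ : 0 < δ) :
    (∀ f ∈ PADR.ruleClass 𝒳 d K μ, Integrable (fun w : 𝒳 × 𝒴 => φ (f w.1) w.2) D) ∧
    (∀ T : Fin n → 𝒳 × 𝒴,
      IsGreatest (PADR.gaps D φ (PADR.ruleClass 𝒳 d K μ) T)
        (PADR.uniformGap D φ (PADR.ruleClass 𝒳 d K μ) T)) ∧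
    Measurable (fun ω => PADR.uniformGap D φ (PADR.ruleClass 𝒳 d K μ) (fun s => S s ω)) ∧
    1 - δ ≤ P.real {ω |
      PADR.uniformGap D φ (PADR.ruleClass 𝒳 d K μ) (fun s => S s ω) ≤
        8 * μ * L * √(2 * d * K * (p + 1) * (p * Xbar ^ 2 + 1)) / n
        + 2 * PADR.costBound p d μ Xbar L C z₀ * √(2 * d * K * (p + 1) * Real.log n / n)
        + √2 * PADR.costBound p d μ Xbar L C z₀ * √(Real.log (2 / δ) / n)} := by
  have hn₀ : n ≠ 0 := Nat.one_le_iff_ne_zero.1 hn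
  obtain ⟨w₀⟩ := nonempty_of_isProbabilityMeasure D
  lift Xbar to ℝ≥0 using (norm_nonneg _).trans (hXbar w₀.1 w₀.1.2)
  lift μ to ℝ≥0 using hμ
  set A := Metric.closedBall (0 : Fin d → PADR.Param p K) μ
  have hA₀ : A.Nonempty := Metric.nonempty_closedBall.2 μ.coe_nonneg
  have hmeas : ∀ θ ∈ A, Measurable (PADR.ruleCost φ θ : 𝒳 × 𝒴 → ℝ) := fun θ _ =>
    PADR.measurable_ruleCost hφm hφL θ
  have hbdd : ∀ θ ∈ A, ∀ w : 𝒳 × 𝒴, |PADR.ruleCost φ θ w| ≤ PADR.costBound p d μ Xbar L C z₀ :=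
    fun θ hθ => PADR.abs_ruleCost_le hXbar hφL hφC (mem_closedBall_zero_iff.1 hθ)
  have hint : ∀ θ ∈ A, Integrable (PADR.ruleCost φ θ) D := fun θ hθ =>
    Integrable.of_bound (hmeas θ hθ).aestronglyMeasurable _ (ae_of_all _ (hbdd θ hθ))
  have hlip (w : 𝒳 × 𝒴) := (PADR.lipschitzWith_ruleCost hXbar hφL w).lipschitzOnWith (s := A)
  have hcont (T : Fin n → 𝒳 × 𝒴) := (PADR.lipschitzOnWith_deviation hint hlip T).continuousOn
  simp only [PADR.uniformGap, PADR.gaps_ruleClass D μ.coe_nonneg]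
  rw [PADR.ruleClass_eq_image μ.coe_nonneg, Set.forall_mem_image]
  refine ⟨fun θ hθ => hint θ hθ, fun T => ?_, ?_, ?_⟩
  · exact ((isCompact_closedBall _ _).image_of_continuousOn (hcont T)).isGreatest_sSup
      (hA₀.image _)
  · exact (PADR.measurable_sSup_image hcont fun θ hθ =>
      PADR.measurable_deviation (hmeas θ hθ)).comp (measurable_pi_lambda _ hSm)
  · have hHoeffding := PADR.one_sub_le_measureReal_sSup_deviation_le hA₀
      (PADR.coveringNumber_closedBall_param_le hn₀ 0) hn₀
      (fun s => ⟨(hSm s).aemeasurable, hSlaw s⟩) hSindep hmeas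
      (PADR.costBound_pos hC p d μ Xbar L z₀) hbdd hlip hδ
    refine hHoeffding.trans (measureReal_mono (Set.ofPred_subset_ofPred.2 fun ω hω => hω.trans ?_))
    exact PADR.lipschitz_error_add_union_bound_error_le hK hn₀ L Xbar μ
      (PADR.costBound_pos hC p d μ Xbar L z₀).le hδ.ne'

theorem proposition2
    {Ω 𝒴 : Type*} [MeasurableSpace Ω] [MeasurableSpace 𝒴]
    {p d K n : ℕ} (hK : 1 ≤ K) (hn : 1 ≤ n)
    -- the compact feature set, with `max_{x ∈ 𝒳} ‖x‖_∞ = Xbar > 0`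
    (𝒳 : Set (Fin p → ℝ)) (h𝒳 : IsCompact 𝒳) (Xbar : ℝ) (hXbar : 0 < Xbar)
    (hmax : IsGreatest ((fun x => ‖x‖) '' 𝒳) Xbar)
    -- the joint law of `(X, Y)`
    (D : Measure (𝒳 × 𝒴)) [IsProbabilityMeasure D]
    -- the i.i.d. sample
    (P : Measure Ω) [IsProbabilityMeasure P]
    (S : Fin n → Ω → 𝒳 × 𝒴) (hSm : ∀ s, Measurable (S s))
    (hSlaw : ∀ s, P.map (S s) = D) (hSindep : iIndepFun S P)
    -- the cost function
    (φ : EuclideanSpace ℝ (Fin d) → 𝒴 → ℝ) (hφm : ∀ z, Measurable (φ z))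
    (L : ℝ≥0) (hL : 0 < L) (hφL : ∀ y, LipschitzWith L (fun z => φ z y))
    (C : ℝ) (hC : 0 < C) (z₀ : EuclideanSpace ℝ (Fin d)) (hφC : ∀ y, |φ z₀ y| ≤ C)
    (μ : ℝ) (hμ : 0 ≤ μ) (δ : ℝ) (hδ : 0 < δ) :
    -- the expected costs are well defined
    (∀ f ∈ PADR.ruleClass 𝒳 d K μ, Integrable (fun w : 𝒳 × 𝒴 => φ (f w.1) w.2) D) ∧
    -- the uniform gap is a maximum, whatever the sample is
    (∀ T : Fin n → 𝒳 × 𝒴,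
      IsGreatest (PADR.gaps D φ (PADR.ruleClass 𝒳 d K μ) T)
        (PADR.uniformGap D φ (PADR.ruleClass 𝒳 d K μ) T)) ∧
    -- the uniform gap of the random sample is a random variable
    Measurable (fun ω => PADR.uniformGap D φ (PADR.ruleClass 𝒳 d K μ) (fun s => S s ω)) ∧
    -- the bound, with probability at least `1 - δ`
    1 - δ ≤ P.real {ω |
      PADR.uniformGap D φ (PADR.ruleClass 𝒳 d K μ) (fun s => S s ω) ≤
        8 * μ * L * √(2 * d * K * (p + 1) * (p * Xbar ^ 2 + 1)) / n
        + 2 * PADR.costBound p d μ Xbar L C z₀ * √(2 * d * K * (p + 1) * Real.log n / n)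
        + √2 * PADR.costBound p d μ Xbar L C z₀ * √(Real.log (2 / δ) / n)} :=
  proposition2_general hK hn 𝒳 Xbar (fun x hx => hmax.2 ⟨x, hx, rfl⟩) D P S hSm hSlaw hSindep
    φ hφm L hφL C hC z₀ hφC μ hμ δ hδ
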